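/- Consider a sequence of experiments indexed by the sample size $n$. In the $n$th experiment the units are $1,\dots,n$, the treatment assignment is a random vector $\mathbf Z=(Z_1,\dots,Z_n)\in\{0,1\}^n$ with an arbitrary distribution (the design), and unit $i$ has a potential outcome function $y_i:\{0,1\}^n\to\mathbb R$ and the observed outcome $Y_i=y_i(\mathbf Z)$. All these objects may depend on $n$. Write $y_i(b;\mathbf z_{-i})$ for the value of $y_i$ at the vector $\mathbf z$ with its $i$th entry replaced by $b$, and let $p_i=\Pr(Z_i=1)$. Define $$\tau_{\mathrm{EATE}}=\mathrm E\Big[\frac1n\sum_{i=1}^n\big(y_i(1;\mathbf Z_{-i})-y_i(0;\mathbf Z_{-i})\big)\Big],$$ $$\hat\tau_{\mathrm{HT}}=\frac1n\sum_{i=1}^n\frac{Z_iY_i}{p_i}-\frac1n\sum_{i=1}^n\frac{(1-Z_i)Y_i}{1-p_i},\qquad \hat\tau_{\mathrm{HA}}=\frac{\sum_{i} Z_iY_i/p_i}{\sum_{i} Z_i/p_i}-\frac{\sum_{i}(1-Z_i)Y_i/(1-p_i)}{\sum_{i}(1-Z_i)/(1-p_i)}$$ (a ratio with denominator $0$ is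 given the value $0$). Let $I_{ij}=1$ if $i=j$ or if there are $\mathbf z,\mathbf z'\in\{0,1\}^n$ that agree outside the $i$th entry with $y_j(\mathbf z)\neq y_j(\mathbf z')$, and $I_{ij}=0$ otherwise. Let $d_{ij}=1$ if $I_{\ell i}I_{\ell j}=1$ for some unit $\ell$, and $d_{ij}=0$ otherwise, and let $d_{\mathrm{avg}}=\frac1n\sum_{i,j}d_{ij}$. Let $\widetilde{\mathbf Z}_i=(I_{1i}Z_1,\dots,I_{ni}Z_n)$, and let $\widetilde{\mathbf Z}_{-i}$ be $\widetilde{\mathbf Z}_i$ with its $i$th entry deleted. For random variables $X,Y$ let $$\alpha(X,Y)=\sup_{A\in\sigma(X),\,B\in\sigma(Y)}\big|\Pr(A\cap B)-\Pr(A)\Pr(B)\big|.$$ Suppose that the following regularity conditions hold with constants $0<k<\infty$, $q\in[2,\infty]$ and $s\in[1,\infty]$, for every $n$, every unit $i$ and $b\in\{0,1\}$: $k^{-1}\le p_i\le 1-k^{-1}$; $\mathrm E[|Y_i|^q]\le k^q$; $\mathrm E[|y_i(b;\mathbf Z_{-i})|^s]\le k^s$, where for $q=\infty$ or $s=\infty$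 the moment bound means that the variable is almost surely bounded by $k$ in absolute value. Define $$\alpha_{\mathrm{ext}}=\frac1n\sum_{i=1}^n\sum_{j=1}^n(1-d_{ij})\,\alpha(\widetilde{\mathbf Z}_i,\widetilde{\mathbf Z}_j)^{(q-2)/q},\qquad \alpha_{\mathrm{int}}=\sum_{i=1}^n\alpha(Z_i,\widetilde{\mathbf Z}_{-i})^{(s-1)/s},$$ where $0^0=0$, and where the exponents are $1$ if $q=\infty$ or $s=\infty$, respectively. If $d_{\mathrm{avg}}=o(n)$ (restricted interference), $\alpha_{\mathrm{ext}}=o(n)$ (design mixing) and $\alpha_{\mathrm{int}}=o(n)$ (design separation), then both estimators are consistent for $\tau_{\mathrm{EATE}}$, that is, $\hat\tau_{\mathrm{HT}}-\tau_{\mathrm{EATE}}\to0$ and $\hat\tau_{\mathrm{HA}}-\tau_{\mathrm{EATE}}\to0$ in probability as $n\to\infty$, and $$\hat\tau_{\mathrm{HT}}-\tau_{\mathrm{EATE}}=O_p\big(n^{-1/2}d_{\mathrm{avg}}^{1/2}+n^{-1/2}\alpha_{\mathrm{ext}}^{1/2}+n^{-1}\alpha_{\mathrm{int}}\big),$$ $$\hat\tau_{\mathrm{HA}}-\tau_{\mathrm{EATE}}=O_p\big(n^{-1/2}d_{\mathrm{avg}}^{1/2}+n^{-1/2}\alpha_{\mathrm{ext}}^{1/2}+n^{-1}\alpha_{\mathrm{int}}\big).$$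 -/

import Mathlib

open MeasureTheory Filter Topology Asymptotics
open scoped ENNReal

noncomputable section

namespace Interference

/-! A sample of `n` units is indexed by `Fin n`; an intervention is a vector
`z : Fin n → Bool` (`true` is treatment). The potential outcomes are functions
`y i : (Fin n → Bool) → ℝ`, and the design is a probability measure on `Fin n → Bool`, under
which the assignment vector is the identity map. -/

/-- The treatment of a unit as a real number, `0` or `1`. -/
def treat (b : Bool) : ℝ := if b then 1 else 0

/-- `y_i(b; z_{-i})`: the potential outcome of unit `i` when its own treatment is set to `b` and
all other treatments are as in `z`. -/
def potential {n : ℕ} (y : Fin n → (Fin n → Bool) → ℝ) (i : Fin n) (b : Bool)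
    (z : Fin n → Bool) : ℝ :=
  y i (Function.update z i b)

/-- The assignment-conditional average treatment effect `τ_ATE(z)`. -/
def acate {n : ℕ} (y : Fin n → (Fin n → Bool) → ℝ) (z : Fin n → Bool) : ℝ :=
  (1 / (n : ℝ)) * ∑ i, (potential y i true z - potential y i false z)

/-- The expected average treatment effect `τ_EATE = E[τ_ATE(Z)]`. -/
def eate {n : ℕ} (P : Measure (Fin n → Bool)) (y : Fin n → (Fin n → Bool) → ℝ) : ℝ :=
  ∫ z, acate y z ∂P

/-- The marginal treatment probability `p_i = Pr(Z_i = 1)`. -/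
def treatProb {n : ℕ} (P : Measure (Fin n → Bool)) (i : Fin n) : ℝ :=
  P.real {z | z i = true}

/-- The Horvitz-Thompson estimator; the observed outcome of unit `i` is `Y_i = y_i(Z)`. -/
def horvitzThompson {n : ℕ} (P : Measure (Fin n → Bool)) (y : Fin n → (Fin n → Bool) → ℝ)
    (z : Fin n → Bool) : ℝ :=
  (1 / (n : ℝ)) * ∑ i, treat (z i) * y i z / treatProb P i
    - (1 / (n : ℝ)) * ∑ i, (1 - treat (z i)) * y i z / (1 - treatProb P i)

/-- The Hájek estimator. If no unit (or every unit) is treated, one of the two denominators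
vanishes, and the corresponding ratio is then given the value `0`. -/
def hajek {n : ℕ} (P : Measure (Fin n → Bool)) (y : Fin n → (Fin n → Bool) → ℝ)
    (z : Fin n → Bool) : ℝ :=
  (∑ i, treat (z i) * y i z / treatProb P i) / (∑ i, treat (z i) / treatProb P i)
    - (∑ i, (1 - treat (z i)) * y i z / (1 - treatProb P i)) /
        (∑ i, (1 - treat (z i)) / (1 - treatProb P i))

/-- `I_{ij} = 1`: unit `i` interferes with unit `j`, or `i = j`. -/
def Interferes {n : ℕ} (y : Fin n → (Fin n → Bool) → ℝ) (i j : Fin n) : Prop :=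
  i = j ∨ ∃ z z' : Fin n → Bool, (∀ k, k ≠ i → z k = z' k) ∧ y j z ≠ y j z'

/-- `d_{ij} = 1`: some unit interferes both with `i` and with `j`. -/
def Dependent {n : ℕ} (y : Fin n → (Fin n → Bool) → ℝ) (i j : Fin n) : Prop :=
  ∃ l, Interferes y l i ∧ Interferes y l j

open scoped Classical in
/-- The interference dependence indicator `d_{ij}` as a real number. -/
def depInd {n : ℕ} (y : Fin n → (Fin n → Bool) → ℝ) (i j : Fin n) : ℝ :=
  if Dependent y i j then 1 else 0

/-- The unit-average number of interference dependencies `d_avg`. -/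
def dAvg {n : ℕ} (y : Fin n → (Fin n → Bool) → ℝ) : ℝ :=
  (1 / (n : ℝ)) * ∑ i, ∑ j, depInd y i j

open scoped Classical in
/-- The vector of all treatments affecting unit `i`, with zeros in the other positions. -/
def affecting {n : ℕ} (y : Fin n → (Fin n → Bool) → ℝ) (i : Fin n) (z : Fin n → Bool) :
    Fin n → Bool :=
  fun j => if Interferes y j i then z j else false

/-- The vector of all treatments affecting unit `i`, with the `i`th entry deleted. -/
def affectingOthers {n : ℕ} (y : Fin n → (Fin n → Bool) → ℝ) (i : Fin n) (z : Fin n → Bool) :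
    {j : Fin n // j ≠ i} → Bool :=
  fun j => affecting y i z j

/-- The alpha-mixing coefficient of two random variables:
`sup |Pr(A ∩ B) - Pr(A) Pr(B)|` over `A ∈ σ(X)` and `B ∈ σ(Y)`. -/
def alphaMixing {Ω E F : Type*} [MeasurableSpace Ω] [mE : MeasurableSpace E]
    [mF : MeasurableSpace F] (P : Measure Ω) (X : Ω → E) (Y : Ω → F) : ℝ :=
  sSup {c : ℝ | ∃ A B : Set Ω, MeasurableSet[mE.comap X] A ∧ MeasurableSet[mF.comap Y] B ∧
    c = |P.real (A ∩ B) - P.real A * P.real B|}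

/-- The power `a ^ e` with the convention `0 ^ 0 = 0`. -/
def powZero (a e : ℝ) : ℝ := if a = 0 then 0 else a ^ e

/-- The external average mixing coefficient `α_ext`. The exponent is `(q - 2) / q` for finite
`q ≥ 2`, and `1` for `q = ∞`. -/
def alphaExt {n : ℕ} (P : Measure (Fin n → Bool)) (y : Fin n → (Fin n → Bool) → ℝ)
    (q : ℝ≥0∞) : ℝ :=
  (1 / (n : ℝ)) * ∑ i, ∑ j, (1 - depInd y i j) *
    powZero (alphaMixing P (affecting y i) (affecting y j)) (1 - 2 / q).toReal

/-- The internal average mixing coefficient `α_int`. The exponent is `(s - 1) / s` for finite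
`s ≥ 1`, and `1` for `s = ∞`. -/
def alphaInt {n : ℕ} (P : Measure (Fin n → Bool)) (y : Fin n → (Fin n → Bool) → ℝ)
    (s : ℝ≥0∞) : ℝ :=
  ∑ i, powZero (alphaMixing P (fun z => z i) (affectingOthers y i)) (1 - 1 / s).toReal

/-- The regularity conditions on a sequence of experiments, with constants `k`, `q` and `s`.
The bound `eLpNorm X q P ≤ k` says `E[|X|^q] ≤ k^q` when `q` is finite, and `|X| ≤ k` almost
surely when `q = ∞`. -/
structure Regular (P : ∀ n : ℕ, Measure (Fin n → Bool))
    (y : ∀ n : ℕ, Fin n → (Fin n → Bool) → ℝ) (k : ℝ) (q s : ℝ≥0∞) : Prop where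
  k_pos : 0 < k
  two_le_q : 2 ≤ q
  one_le_s : 1 ≤ s
  prob_assignment : ∀ n (i : Fin n), k⁻¹ ≤ treatProb (P n) i ∧ treatProb (P n) i ≤ 1 - k⁻¹
  outcome_moments : ∀ n (i : Fin n), eLpNorm (y n i) q (P n) ≤ ENNReal.ofReal k
  potential_moments : ∀ n (i : Fin n) (b : Bool),
    eLpNorm (potential (y n) i b) s (P n) ≤ ENNReal.ofReal k

/-- `X_n → 0` in probability, where `X_n` lives on its own probability space. -/
def TendstoZeroInProb {Ω : ℕ → Type*} [∀ n, MeasurableSpace (Ω n)] (P : ∀ n, Measure (Ω n))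
    (X : ∀ n, Ω n → ℝ) : Prop :=
  ∀ ε : ℝ, 0 < ε → Tendsto (fun n => (P n).real {ω | ε ≤ |X n ω|}) atTop (𝓝 0)

/-- `X_n = O_p(a_n)`, where `X_n` lives on its own probability space. -/
def IsBigOInProb {Ω : ℕ → Type*} [∀ n, MeasurableSpace (Ω n)] (P : ∀ n, Measure (Ω n))
    (X : ∀ n, Ω n → ℝ) (a : ℕ → ℝ) : Prop :=
  ∀ ε : ℝ, 0 < ε → ∃ M : ℝ, 0 < M ∧
    ∀ᶠ n in atTop, (P n).real {ω | M * a n < |X n ω|} ≤ ε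

/-- The rate `n^{-1/2} d_avg^{1/2} + n^{-1/2} α_ext^{1/2} + n^{-1} α_int`. -/
def rate {n : ℕ} (P : Measure (Fin n → Bool)) (y : Fin n → (Fin n → Bool) → ℝ)
    (q s : ℝ≥0∞) : ℝ :=
  (n : ℝ) ^ (-(1 / 2) : ℝ) * dAvg y ^ (1 / 2 : ℝ)
    + (n : ℝ) ^ (-(1 / 2) : ℝ) * alphaExt P y q ^ (1 / 2 : ℝ)
    + (n : ℝ)⁻¹ * alphaInt P y s

end Interference

end

/-! Both estimators are differences over the two arms `b` of inverse probability weighted means; the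
Hájek estimator also divides each mean by the mean weight. It suffices to bound mean square errors,
that is, variance plus squared bias, by a multiple of the squared rate and apply Markov's
inequality.

Variance (`variance_mean_le`): each summand is a function of the treatments affecting its unit.
Pairs with `d_ij = 1` have bounded covariance, and Davydov's inequality
(`abs_covariance_le_powZero`) bounds the others by mixing coefficients, for a total of order `(d_avg
+ α_ext) / n`.

Bias (`abs_integral_armMean_sub_le`): a weight has mean one and vanishes off its arm, so the bias is
an average of covariances between a function of `Z_i` and a function of the other treatments
affecting `i`. Davydov's inequality for a bounded variable gives order `α_int / n`.

Mean weights are unbiased for one and have the same variance bound, so `IsBigOInProb.div_sub`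
transfers the rate to the ratios. -/

noncomputable section

namespace Interference

/-! ### Davydov's covariance inequalities, by truncation. -/

section Covariance

open ProbabilityTheory

/-- The part of `X` above the level `c` in absolute value. -/
def tail {Ω : Type*} (c : ℝ) (X : Ω → ℝ) (ω : Ω) : ℝ := if |X ω| ≤ c then 0 else X ω

/-- `X` truncated at the level `c`. -/
def trunc {Ω : Type*} (c : ℝ) (X : Ω → ℝ) (ω : Ω) : ℝ := if |X ω| ≤ c then X ω else 0

theorem trunc_add_tail {Ω : Type*} (c : ℝ) (X : Ω → ℝ) : trunc c X + tail c X = X := by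
  ext ω
  by_cases h : |X ω| ≤ c <;> simp [trunc, tail, h]

theorem abs_trunc_le {Ω : Type*} {c : ℝ} (hc : 0 ≤ c) (X : Ω → ℝ) (ω : Ω) : |trunc c X ω| ≤ c := by
  by_cases h : |X ω| ≤ c <;> simp [trunc, h, hc]

theorem measurable_trunc {Ω : Type*} {m : MeasurableSpace Ω} (c : ℝ) {X : Ω → ℝ}
    (hX : Measurable[m] X) :
    Measurable[m] (trunc c X) :=
  Measurable.ite (measurableSet_le (by fun_prop) measurable_const) hX measurable_const

variable {Ω : Type*} [mΩ : MeasurableSpace Ω]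

/-- A centred variable integrates against a bounded `m`-measurable one at most as much as against
the indicator of some `m`-measurable event, up to a factor `2 a`. -/
theorem exists_abs_integral_mul_le {P : Measure Ω} [IsFiniteMeasure P]
    {m : MeasurableSpace Ω} (hm : m ≤ mΩ) {X W : Ω → ℝ} {a : ℝ} (hX : Measurable[m] X)
    (hXa : ∀ ω, |X ω| ≤ a) (hW : Integrable W P) (hW0 : ∫ ω, W ω ∂P = 0) :
    ∃ A, MeasurableSet[m] A ∧ |∫ ω, X ω * W ω ∂P| ≤ 2 * a * ∫ ω in A, W ω ∂P := by
  -- Conditioning replaces `W` by the `m`-measurable `V`. Since `V` has mean zero, its positive and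
  -- negative parts have equal integrals, so the event `0 ≤ V` carries half of the integral of
  -- `|V|`.
  set V : Ω → ℝ := P[W | m]
  have hVm : Measurable[m] V := stronglyMeasurable_condExp.measurable
  have hVi : Integrable V P := integrable_condExp
  have hA : MeasurableSet[m] {ω | 0 ≤ V ω} := hVm measurableSet_Ici
  have hbound : ∀ᵐ ω ∂P, ‖X ω‖ ≤ a := ae_of_all _ hXa
  have hXV : Integrable (fun ω => X ω * V ω) P :=
    hVi.bdd_mul (hX.mono hm le_rfl).aestronglyMeasurable hbound
  have h1 : ∫ ω, X ω * W ω ∂P = ∫ ω, X ω * V ω ∂P := by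
    rw [← integral_condExp hm]
    exact integral_congr_ae
      (condExp_stronglyMeasurable_mul_of_bound hm hX.stronglyMeasurable hW a hbound)
  have h2 : |∫ ω, X ω * V ω ∂P| ≤ ∫ ω, a * |V ω| ∂P := by
    refine abs_integral_le_integral_abs.trans ?_
    refine integral_mono hXV.abs (hVi.abs.const_mul a) fun ω => ?_
    simp only [abs_mul]
    exact mul_le_mul_of_nonneg_right (hXa ω) (abs_nonneg _)
  have h3 : ∫ ω, |V ω| ∂P = 2 * ∫ ω in {ω | 0 ≤ V ω}, V ω ∂P := by
    have hs : ∫ ω in {ω | 0 ≤ V ω}, V ω ∂P + ∫ ω in {ω | 0 ≤ V ω}ᶜ, V ω ∂P = 0 := by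
      rw [integral_add_compl (hm _ hA) hVi, integral_condExp hm, hW0]
    rw [← integral_add_compl (hm _ hA) hVi.abs,
      setIntegral_congr_fun (g := V) (hm _ hA) fun ω hω => abs_of_nonneg hω,
      setIntegral_congr_fun (g := fun ω => -V ω) (hm _ hA.compl)
        fun ω hω => abs_of_neg (not_le.1 hω), integral_neg]
    linarith
  refine ⟨_, hA, ?_⟩
  rw [h1, ← setIntegral_condExp hm hW hA]
  refine h2.trans (le_of_eq ?_)
  rw [integral_const_mul, h3]
  ring

variable {E F : Type*} [mE : MeasurableSpace E] [mF : MeasurableSpace F]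
  {P : Measure Ω} {U : Ω → E} {V : Ω → F}

theorem alphaMixing_nonneg : 0 ≤ alphaMixing P U V := by
  refine Real.sSup_nonneg ?_
  rintro _ ⟨A, B, -, -, rfl⟩
  exact abs_nonneg _

variable [IsProbabilityMeasure P]

theorem abs_real_inter_sub_le_one (A B : Set Ω) :
    |P.real (A ∩ B) - P.real A * P.real B| ≤ 1 := by
  have h1 : P.real (A ∩ B) ≤ 1 := measureReal_le_one
  have h2 : P.real A * P.real B ≤ 1 :=
    mul_le_one₀ measureReal_le_one measureReal_nonneg measureReal_le_one
  have h3 : 0 ≤ P.real (A ∩ B) := measureReal_nonneg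
  have h4 : 0 ≤ P.real A * P.real B := mul_nonneg measureReal_nonneg measureReal_nonneg
  rw [abs_le]
  constructor <;> linarith

theorem le_alphaMixing {A B : Set Ω} (hA : MeasurableSet[mE.comap U] A)
    (hB : MeasurableSet[mF.comap V] B) :
    |P.real (A ∩ B) - P.real A * P.real B| ≤ alphaMixing P U V := by
  refine le_csSup ⟨1, ?_⟩ ⟨A, B, hA, hB, rfl⟩
  rintro _ ⟨A, B, -, -, rfl⟩
  exact abs_real_inter_sub_le_one A B

variable [Finite Ω] [DiscreteMeasurableSpace Ω]

/-- Two uses of `exists_abs_integral_mul_le`, each costing a factor 2, replace first `X` and then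
`Y` by events `A` and `B`. -/
theorem abs_covariance_le_of_bounded {X Y : Ω → ℝ} {a b : ℝ} (ha : 0 ≤ a) (hb : 0 ≤ b)
    (hX : Measurable[mE.comap U] X) (hY : Measurable[mF.comap V] Y)
    (hXa : ∀ ω, |X ω| ≤ a) (hYb : ∀ ω, |Y ω| ≤ b) :
    |cov[X, Y; P]| ≤ 4 * a * b * alphaMixing P U V := by
  have hU : mE.comap U ≤ mΩ := (Measurable.of_discrete (f := U)).comap_le
  have hV : mF.comap V ≤ mΩ := (Measurable.of_discrete (f := V)).comap_le
  have hYc : ∫ ω, (Y ω - P[Y]) ∂P = 0 := by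
    rw [integral_sub .of_finite .of_finite]; simp
  obtain ⟨A, hA, hXA⟩ := exists_abs_integral_mul_le hU hX hXa 
    (W := fun ω => Y ω - P[Y]) .of_finite hYc
  have hAc : ∫ ω, (A.indicator 1 ω - P.real A) ∂P = 0 := by
    rw [integral_sub .of_finite .of_finite, integral_indicator_one (hU _ hA)]; simp
  obtain ⟨B, hB, hYB⟩ := exists_abs_integral_mul_le hV hY hYb
    (W := fun ω => A.indicator 1 ω - P.real A) .of_finite hAc
  have h1 : cov[X, Y; P] = ∫ ω, X ω * (Y ω - P[Y]) ∂P := by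
    have : cov[X, Y; P] = ∫ ω, (X ω * (Y ω - P[Y]) - P[X] * (Y ω - P[Y])) ∂P := by
      simp only [covariance, sub_mul]
    rw [this, integral_sub .of_finite .of_finite, integral_const_mul, hYc]
    ring
  have h2 : ∫ ω in A, (Y ω - P[Y]) ∂P = ∫ ω, Y ω * (A.indicator 1 ω - P.real A) ∂P := by
    have : ∀ ω, Y ω * (A.indicator 1 ω - P.real A) = A.indicator Y ω - Y ω * P.real A := by
      intro ω
      by_cases h : ω ∈ A <;> simp [h, mul_sub]
    simp_rw [this]
    rw [integral_sub .of_finite .of_finite, integral_sub .of_finite .of_finite,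
      integral_indicator (hU _ hA), integral_mul_const]
    simp [mul_comm]
  have h3 : ∫ ω in B, (A.indicator 1 ω - P.real A) ∂P
      = P.real (A ∩ B) - P.real A * P.real B := by
    rw [integral_sub .of_finite .of_finite, integral_indicator_one (hU _ hA),
      measureReal_restrict_apply (hU _ hA)]
    simp [mul_comm]
  rw [h1]
  calc _ ≤ 2 * a * ∫ ω in A, (Y ω - P[Y]) ∂P := hXA
    _ ≤ 2 * a * (2 * b * alphaMixing P U V) := by
        gcongr
        rw [h2]
        refine (le_abs_self _).trans (hYB.trans ?_)
        gcongr
        rw [h3]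
        exact (le_abs_self _).trans (le_alphaMixing hA hB)
    _ = _ := by ring

/-- On a finite space every variable is bounded. This settles the case `α = 0`, where the truncation
level below is unavailable and the convention `0 ^ 0 = 0` demands an exact zero. -/
theorem covariance_eq_zero_of_alphaMixing_eq_zero {X Y : Ω → ℝ}
    (hX : Measurable[mE.comap U] X) (hY : Measurable[mF.comap V] Y)
    (h : alphaMixing P U V = 0) : cov[X, Y; P] = 0 := by
  have hb : ∀ X : Ω → ℝ, ∃ a, 0 ≤ a ∧ ∀ ω, |X ω| ≤ a := by
    intro X
    obtain ⟨a, ha⟩ := (Set.finite_range fun ω => |X ω|).bddAbove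
    exact ⟨max a 0, le_max_right _ _, fun ω => (ha ⟨ω, rfl⟩).trans (le_max_left _ _)⟩
  obtain ⟨a, ha, hXa⟩ := hb X
  obtain ⟨b, hb, hYb⟩ := hb Y
  have := abs_covariance_le_of_bounded (P := P) ha hb hX hY hXa hYb
  rw [h, mul_zero] at this
  exact abs_eq_zero.1 (le_antisymm this (abs_nonneg _))

theorem abs_covariance_le_integral_abs {X Y : Ω → ℝ} {a : ℝ} (hXa : ∀ ω, |X ω| ≤ a) :
    |cov[X, Y; P]| ≤ 2 * a * ∫ ω, |Y ω| ∂P := by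
  have h1 : |P[X * Y]| ≤ a * ∫ ω, |Y ω| ∂P := by
    rw [← integral_const_mul]
    refine abs_integral_le_integral_abs.trans (integral_mono .of_finite .of_finite fun ω => ?_)
    simp only [Pi.mul_apply, abs_mul]
    exact mul_le_mul_of_nonneg_right (hXa ω) (abs_nonneg _)
  have h2 : |P[X]| ≤ a := by
    refine abs_integral_le_integral_abs.trans ?_
    refine (integral_mono .of_finite .of_finite hXa : _ ≤ ∫ _, a ∂P).trans ?_
    simp
  have h3 : |P[Y]| ≤ ∫ ω, |Y ω| ∂P := abs_integral_le_integral_abs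
  rw [covariance_eq_sub .of_discrete .of_discrete]
  refine (abs_sub _ _).trans ?_
  rw [abs_mul]
  have := mul_le_mul h2 h3 (abs_nonneg _) ((abs_nonneg _).trans h2)
  linarith

/-- Nonnegativity of the variances of `X + Y` and `X - Y` gives `2 |cov| ≤ Var X + Var Y`. -/
theorem abs_covariance_le_of_integral_sq {X Y : Ω → ℝ} {c : ℝ}
    (hX : ∫ ω, X ω ^ 2 ∂P ≤ c) (hY : ∫ ω, Y ω ^ 2 ∂P ≤ c) : |cov[X, Y; P]| ≤ c := by
  have hX' : Var[X; P] ≤ c := (variance_le_expectation_sq .of_discrete).trans hX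
  have hY' : Var[Y; P] ≤ c := (variance_le_expectation_sq .of_discrete).trans hY
  have h1 := variance_add (X := X) (Y := Y) (μ := P) .of_discrete .of_discrete
  have h2 := variance_sub (X := X) (Y := Y) (μ := P) .of_discrete .of_discrete
  have h3 := variance_nonneg (X + Y) P
  have h4 := variance_nonneg (X - Y) P
  rw [abs_le]
  constructor <;> linarith

theorem integral_rpow_le {X : Ω → ℝ} {q : ℝ≥0∞} {K : ℝ} (hK : 0 ≤ K) (hq : q ≠ 0)
    (hq' : q ≠ ∞) (hX : eLpNorm X q P ≤ ENNReal.ofReal K) :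
    ∫ ω, |X ω| ^ q.toReal ∂P ≤ K ^ q.toReal := by
  have hpos : 0 < q.toReal := ENNReal.toReal_pos hq hq'
  rw [MemLp.eLpNorm_eq_integral_rpow_norm hq hq' .of_discrete,
    ENNReal.ofReal_le_ofReal_iff hK] at hX
  have h0 : 0 ≤ ∫ ω, |X ω| ^ q.toReal ∂P :=
    integral_nonneg fun ω => Real.rpow_nonneg (abs_nonneg _) _
  have := Real.rpow_le_rpow (Real.rpow_nonneg h0 _) hX hpos.le
  rwa [Real.rpow_inv_rpow h0 hpos.ne'] at this

/-- Above the level `c` one has `|X| ^ r ≤ c ^ (r - q) * |X| ^ q`, because `r ≤ q`. -/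
theorem integral_tail_rpow_le {X : Ω → ℝ} {q : ℝ≥0∞} {K α r : ℝ} (hK : 0 < K) (hα : 0 < α)
    (hr : 0 < r) (hrq : ENNReal.ofReal r ≤ q) (hX : eLpNorm X q P ≤ ENNReal.ofReal K) :
    ∫ ω, |tail (K * α ^ (-(1 / q.toReal))) X ω| ^ r ∂P ≤ K ^ r * α ^ (1 - r / q.toReal) := by
  have hq0 : q ≠ 0 := fun h => by
    rw [h] at hrq; simp at hrq; linarith
  rcases eq_or_ne q ∞ with rfl | hq
  -- As `∞.toReal = 0` and `1 / 0 = 0`, the level is `K` itself and the tail vanishes almost surely.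
  · have : ∀ᵐ ω ∂P, |tail (K * α ^ (-(1 / (∞ : ℝ≥0∞).toReal))) X ω| ^ r = 0 := by
      filter_upwards [enorm_ae_le_eLpNormEssSup X P] with ω hω
      rw [← eLpNorm_exponent_top] at hω
      have h := hω.trans hX
      rw [← ofReal_norm, ENNReal.ofReal_le_ofReal_iff hK.le, Real.norm_eq_abs] at h
      simp [tail, h, hr.ne']
    rw [integral_congr_ae this]
    simp only [integral_zero]
    positivity
  · set e := q.toReal with he
    have hre : r ≤ e := by
      rw [he, ← ENNReal.toReal_ofReal hr.le]
      exact ENNReal.toReal_mono hq hrq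
    have he0 : 0 < e := hr.trans_le hre
    set c := K * α ^ (-(1 / e)) with hc
    have hc0 : 0 < c := by positivity
    have h1 : ∀ ω, |tail c X ω| ^ r ≤ c ^ (r - e) * |X ω| ^ e := by
      intro ω
      by_cases h : |X ω| ≤ c
      · simp only [tail, h, if_true, abs_zero, Real.zero_rpow hr.ne']
        positivity
      · simp only [tail, h, if_false]
        push Not at h
        have hX0 : 0 < |X ω| := hc0.trans h
        calc |X ω| ^ r = |X ω| ^ (r - e) * |X ω| ^ e := by
              rw [← Real.rpow_add hX0]; ring_nf
          _ ≤ _ := by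
              gcongr ?_ * _
              exact Real.rpow_le_rpow_of_nonpos hc0 h.le (by linarith)
    calc _ ≤ ∫ ω, c ^ (r - e) * |X ω| ^ e ∂P := integral_mono .of_finite .of_finite h1
      _ ≤ c ^ (r - e) * K ^ e := by
          rw [integral_const_mul]
          gcongr
          exact integral_rpow_le hK.le hq0 hq hX
      _ = K ^ r * α ^ (1 - r / e) := by
          rw [hc, Real.mul_rpow hK.le (by positivity), ← Real.rpow_mul hα.le, mul_right_comm,
            ← Real.rpow_add hK]
          congr 2
          · ring
          · field_simp
            ring

/-- At `q = ∞` both quotients are zero, so one real formula covers finite and infinite exponents. -/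
theorem toReal_one_sub_div {q c : ℝ≥0∞} (hcq : c ≤ q) :
    (1 - c / q).toReal = 1 - c.toReal / q.toReal := by
  rw [ENNReal.toReal_sub_of_le (ENNReal.div_le_of_le_mul (by simpa using hcq)) (by simp),
    ENNReal.toReal_div, ENNReal.toReal_one]

/-- Davydov's covariance inequality for two variables with bounded `q`-th moments. -/
theorem abs_covariance_le_powZero {X Y : Ω → ℝ} {q : ℝ≥0∞} {K : ℝ} (hK : 0 < K) (hq : 2 ≤ q)
    (hX : Measurable[mE.comap U] X) (hY : Measurable[mF.comap V] Y)
    (hXq : eLpNorm X q P ≤ ENNReal.ofReal K) (hYq : eLpNorm Y q P ≤ ENNReal.ofReal K) :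
    |cov[X, Y; P]| ≤ 9 * K ^ 2 * powZero (alphaMixing P U V) (1 - 2 / q).toReal := by
  rcases eq_or_ne (alphaMixing P U V) 0 with h | h
  · simp [covariance_eq_zero_of_alphaMixing_eq_zero hX hY h, powZero, h]
  have hα : 0 < alphaMixing P U V := lt_of_le_of_ne alphaMixing_nonneg h.symm
  rw [powZero, if_neg h, toReal_one_sub_div hq, ENNReal.toReal_ofNat]
  set α := alphaMixing P U V with hαd
  set c := K * α ^ (-(1 / q.toReal)) with hc
  have hc0 : 0 < c := by positivity
  have t1 : ∀ X : Ω → ℝ, eLpNorm X q P ≤ ENNReal.ofReal K →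
      ∫ ω, |tail c X ω| ∂P ≤ K * α ^ (1 - 1 / q.toReal) := fun X hX => by
    simpa [hc] using integral_tail_rpow_le hK hα one_pos
      (by simpa using (one_le_two.trans hq)) hX
  have t2 : ∀ X : Ω → ℝ, eLpNorm X q P ≤ ENNReal.ofReal K →
      ∫ ω, tail c X ω ^ 2 ∂P ≤ K ^ 2 * α ^ (1 - 2 / q.toReal) := fun X hX => by
    simpa [hc] using integral_tail_rpow_le hK hα two_pos (by simpa using hq) hX
  -- The level `c` makes the bounds for the truncated, mixed and tail covariances of the same order;
  -- they add up to 9 = 4 + 2 + 2 + 1.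
  have hcc : c * c * α = K ^ 2 * α ^ (1 - 2 / q.toReal) := by
    have : α ^ (1 - 2 / q.toReal) = α ^ (-(1 / q.toReal)) * α ^ (-(1 / q.toReal)) * α := by
      rw [← Real.rpow_add hα, ← Real.rpow_add_one hα.ne']; ring_nf
    rw [this, hc]; ring
  have hct : c * (K * α ^ (1 - 1 / q.toReal)) = K ^ 2 * α ^ (1 - 2 / q.toReal) := by
    have : α ^ (1 - 2 / q.toReal) = α ^ (-(1 / q.toReal)) * α ^ (1 - 1 / q.toReal) := by
      rw [← Real.rpow_add hα]; ring_nf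
    rw [this, hc]; ring
  have b1 := abs_covariance_le_of_bounded (P := P) hc0.le hc0.le (measurable_trunc c hX)
    (measurable_trunc c hY) (abs_trunc_le hc0.le X) (abs_trunc_le hc0.le Y)
  have b2 := abs_covariance_le_integral_abs (P := P) (Y := tail c Y) (abs_trunc_le hc0.le X)
  have b3 := abs_covariance_le_integral_abs (P := P) (Y := tail c X) (abs_trunc_le hc0.le Y)
  have b4 := abs_covariance_le_of_integral_sq (P := P) (t2 X hXq) (t2 Y hYq)
  have b2' := mul_le_mul_of_nonneg_left (t1 Y hYq) hc0.le
  have b3' := mul_le_mul_of_nonneg_left (t1 X hXq) hc0.le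
  have hsplit : cov[X, Y; P] = cov[trunc c X, trunc c Y; P] + cov[trunc c X, tail c Y; P]
      + (cov[trunc c Y, tail c X; P] + cov[tail c X, tail c Y; P]) := by
    conv_lhs => rw [← trunc_add_tail c X, ← trunc_add_tail c Y]
    rw [covariance_add_left .of_discrete .of_discrete .of_discrete,
      covariance_add_right .of_discrete .of_discrete .of_discrete,
      covariance_add_right .of_discrete .of_discrete .of_discrete,
      covariance_comm (tail c X) (trunc c Y)]
  rw [hsplit]
  refine (abs_add_le _ _).trans ?_
  have a1 := abs_add_le cov[trunc c X, trunc c Y; P] cov[trunc c X, tail c Y; P]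
  have a2 := abs_add_le cov[trunc c Y, tail c X; P] cov[tail c X, tail c Y; P]
  rw [← hαd] at b1
  linarith

/-- Davydov's covariance inequality for a bounded variable and one with a bounded `s`-th
moment. -/
theorem abs_covariance_le_powZero_of_bounded {X Y : Ω → ℝ} {s : ℝ≥0∞} {a K : ℝ} (hK : 0 < K)
    (ha : 0 ≤ a) (hs : 1 ≤ s) (hX : Measurable[mE.comap U] X) (hY : Measurable[mF.comap V] Y)
    (hXa : ∀ ω, |X ω| ≤ a) (hYs : eLpNorm Y s P ≤ ENNReal.ofReal K) :
    |cov[X, Y; P]| ≤ 6 * a * K * powZero (alphaMixing P U V) (1 - 1 / s).toReal := by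
  rcases eq_or_ne (alphaMixing P U V) 0 with h | h
  · simp [covariance_eq_zero_of_alphaMixing_eq_zero hX hY h, powZero, h]
  have hα : 0 < alphaMixing P U V := lt_of_le_of_ne alphaMixing_nonneg h.symm
  rw [powZero, if_neg h, toReal_one_sub_div hs, ENNReal.toReal_one]
  set α := alphaMixing P U V with hαd
  set c := K * α ^ (-(1 / s.toReal)) with hc
  have hc0 : 0 < c := by positivity
  have t1 : ∫ ω, |tail c Y ω| ∂P ≤ K * α ^ (1 - 1 / s.toReal) := by
    simpa [hc] using integral_tail_rpow_le hK hα one_pos (by simpa using hs) hYs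
  have hcc : c * α = K * α ^ (1 - 1 / s.toReal) := by
    have : α ^ (1 - 1 / s.toReal) = α ^ (-(1 / s.toReal)) * α := by
      rw [← Real.rpow_add_one hα.ne']; ring_nf
    rw [this, hc]; ring
  have b1 := abs_covariance_le_of_bounded (P := P) ha hc0.le hX
    (measurable_trunc c hY) hXa (abs_trunc_le hc0.le Y)
  have b2 := abs_covariance_le_integral_abs (P := P) (Y := tail c Y) hXa
  have b2' := mul_le_mul_of_nonneg_left t1 ha
  have hsplit : cov[X, Y; P] = cov[X, trunc c Y; P] + cov[X, tail c Y; P] := by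
    conv_lhs => rw [← trunc_add_tail c Y]
    rw [covariance_add_right .of_discrete .of_discrete .of_discrete]
  rw [hsplit]
  refine (abs_add_le _ _).trans ?_
  -- Only `Y` is truncated, so the constant is 6 = 4 + 2.
  have hcc' : 4 * a * c * α = 4 * (a * (K * α ^ (1 - 1 / s.toReal))) := by rw [← hcc]; ring
  rw [← hαd, hcc'] at b1
  linarith

end Covariance

/-! ### Calculus of stochastic orders. -/

section Probability

variable {Ω : ℕ → Type*} [∀ n, MeasurableSpace (Ω n)] {P : ∀ n, Measure (Ω n)}
  {X Y : ∀ n, Ω n → ℝ} {a : ℕ → ℝ}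

theorem IsBigOInProb.congr (hX : IsBigOInProb P X a) (h : ∀ᶠ n in atTop, X n = Y n) :
    IsBigOInProb P Y a := by
  intro ε hε
  obtain ⟨M, hM, hX⟩ := hX ε hε
  refine ⟨M, hM, ?_⟩
  filter_upwards [hX, h] with n hXn hn
  rwa [← hn]

variable [∀ n, IsFiniteMeasure (P n)]

theorem IsBigOInProb.tendstoZeroInProb (h : IsBigOInProb P X a) (ha : Tendsto a atTop (𝓝 0)) :
    TendstoZeroInProb P X := by
  intro ε hε
  rw [tendsto_order]
  refine ⟨fun c hc => .of_forall fun n => hc.trans_le measureReal_nonneg, fun c hc => ?_⟩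
  obtain ⟨M, hM, h⟩ := h (c / 2) (half_pos hc)
  have hMa : Tendsto (fun n => M * a n) atTop (𝓝 0) := by simpa using ha.const_mul M
  filter_upwards [h, hMa.eventually_lt_const hε] with n hn hlt
  refine (measureReal_mono fun ω hω => ?_).trans_lt (hn.trans_lt (half_lt_self hc))
  exact hlt.trans_le hω

theorem IsBigOInProb.sub (hX : IsBigOInProb P X a) (hY : IsBigOInProb P Y a) :
    IsBigOInProb P (fun n ω => X n ω - Y n ω) a := by
  intro ε hε
  obtain ⟨M, hM, hX⟩ := hX (ε / 2) (half_pos hε)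
  obtain ⟨N, hN, hY⟩ := hY (ε / 2) (half_pos hε)
  refine ⟨M + N, by positivity, ?_⟩
  filter_upwards [hX, hY] with n hXn hYn
  refine (measureReal_mono (s₂ := {ω | M * a n < |X n ω|} ∪ {ω | N * a n < |Y n ω|})
    fun ω hω => ?_).trans ((measureReal_union_le _ _).trans (by linarith))
  by_contra! hc
  simp only [Set.mem_union, Set.mem_ofPred_eq, not_or, not_lt] at hc hω
  have := abs_sub (X n ω) (Y n ω)
  linarith [hc.1, hc.2]

theorem IsBigOInProb.of_integral_sq_le {C : ℝ} (hC : 0 ≤ C)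
    (hX : ∀ᶠ n in atTop, Integrable (fun ω => X n ω ^ 2) (P n) ∧
      ∫ ω, X n ω ^ 2 ∂(P n) ≤ C * a n ^ 2)
    (ha : ∀ᶠ n in atTop, 0 < a n) : IsBigOInProb P X a := by
  intro ε hε
  -- With `M ≥ 1`, `C ≤ M * ε` implies `C ≤ M ^ 2 * ε`, as Markov's inequality for the square
  -- requires, without a square root.
  set M := max 1 (C / ε)
  have hM1 : 1 ≤ M := le_max_left _ _
  have hM2 : C ≤ M * ε := (div_le_iff₀ hε).1 (le_max_right _ _)
  refine ⟨M, by positivity, ?_⟩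
  filter_upwards [hX, ha] with n ⟨hi, hn⟩ han
  have h1 := mul_meas_ge_le_integral_of_nonneg (ae_of_all _ fun ω => sq_nonneg (X n ω)) hi
    ((M * a n) ^ 2)
  have h2 : (P n).real {ω | M * a n < |X n ω|} ≤ (P n).real {ω | (M * a n) ^ 2 ≤ X n ω ^ 2} := by
    refine measureReal_mono fun ω hω => ?_
    simp only [Set.mem_ofPred_eq] at hω ⊢
    rw [← sq_abs (X n ω)]
    exact pow_le_pow_left₀ (by positivity) (le_of_lt hω) 2
  have hpos : 0 < (M * a n) ^ 2 := by positivity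
  refine h2.trans (le_of_mul_le_mul_left (h1.trans (hn.trans ?_)) hpos)
  have : M * ε ≤ M ^ 2 * ε := by nlinarith [mul_le_mul_of_nonneg_right hM1 hε.le]
  calc C * a n ^ 2 ≤ (M ^ 2 * ε) * a n ^ 2 := by gcongr; exact hM2.trans this
    _ = _ := by ring

/-- A ratio whose numerator tracks a bounded `c` and whose denominator tracks `1` tracks `c`. -/
theorem IsBigOInProb.div_sub {N D : ∀ n, Ω n → ℝ} {c : ℕ → ℝ} {k : ℝ}
    (hN : IsBigOInProb P (fun n ω => N n ω - c n) a)
    (hD : IsBigOInProb P (fun n ω => D n ω - 1) a)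
    (hc : ∀ᶠ n in atTop, |c n| ≤ k) (ha : Tendsto a atTop (𝓝 0)) :
    IsBigOInProb P (fun n ω => N n ω / D n ω - c n) a := by
  have hk : 0 ≤ k := by
    obtain ⟨n, hn⟩ := hc.exists
    exact (abs_nonneg _).trans hn
  intro ε hε
  obtain ⟨M, hM, hN⟩ := hN (ε / 2) (half_pos hε)
  obtain ⟨M', hM', hD⟩ := hD (ε / 2) (half_pos hε)
  refine ⟨2 * (M + k * M'), by positivity, ?_⟩
  have hMa : Tendsto (fun n => M' * a n) atTop (𝓝 0) := by simpa using ha.const_mul M'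
  filter_upwards [hN, hD, hc, hMa.eventually_lt_const one_half_pos] with n hNn hDn hcn hlt
  refine (measureReal_mono
    (s₂ := {ω | M * a n < |N n ω - c n|} ∪ {ω | M' * a n < |D n ω - 1|})
    fun ω hω => ?_).trans ((measureReal_union_le _ _).trans (by linarith))
  by_contra! h
  simp only [Set.mem_union, Set.mem_ofPred_eq, not_or, not_lt] at h hω
  obtain ⟨h1, h2⟩ := h
  -- Eventually `M' * a n < 1 / 2`, which keeps the denominator away from zero; dividing by it costs
  -- the factor 2 in the chosen constant.
  have hDpos : 1 / 2 ≤ D n ω := by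
    have := (abs_le.1 (h2.trans hlt.le)).1
    linarith
  have heq : N n ω / D n ω - c n = ((N n ω - c n) - c n * (D n ω - 1)) / D n ω := by
    field_simp
    ring
  rw [heq, abs_div, abs_of_pos (by linarith : 0 < D n ω), lt_div_iff₀ (by linarith)] at hω
  have h3 := abs_sub (N n ω - c n) (c n * (D n ω - 1))
  rw [abs_mul] at h3
  have h4 : |c n| * |D n ω - 1| ≤ k * (M' * a n) :=
    mul_le_mul hcn h2 (abs_nonneg _) hk
  -- The sign of `a n` is not assumed; here it follows from the bounds on the good event.
  have h5 : 0 ≤ (M + k * M') * a n := by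
    have : 0 ≤ |N n ω - c n| + k * |D n ω - 1| := by positivity
    nlinarith [mul_le_mul_of_nonneg_left h2 hk]
  nlinarith [mul_le_mul_of_nonneg_left hDpos h5]

end Probability

/-! ### Low moments from `eLpNorm` bounds, and measurability by factorization. -/

section Moments

variable {Ω : Type*} [MeasurableSpace Ω] [Finite Ω] [DiscreteMeasurableSpace Ω]
  {P : Measure Ω} [IsProbabilityMeasure P] {X : Ω → ℝ} {q : ℝ≥0∞} {K : ℝ}

theorem integral_sq_le (hK : 0 ≤ K) (hq : 2 ≤ q) (hX : eLpNorm X q P ≤ ENNReal.ofReal K) :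
    ∫ ω, X ω ^ 2 ∂P ≤ K ^ 2 := by
  have h := (eLpNorm_le_eLpNorm_of_exponent_le (μ := P) (f := X) hq
    Measurable.of_discrete.aestronglyMeasurable).trans hX
  simpa using integral_rpow_le hK two_ne_zero (by simp) h

theorem abs_integral_le (hK : 0 ≤ K) (hq : 1 ≤ q) (hX : eLpNorm X q P ≤ ENNReal.ofReal K) :
    |∫ ω, X ω ∂P| ≤ K := by
  have h := (eLpNorm_le_eLpNorm_of_exponent_le (μ := P) (f := X) hq
    Measurable.of_discrete.aestronglyMeasurable).trans hX
  exact abs_integral_le_integral_abs.trans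
    (by simpa using integral_rpow_le hK one_ne_zero (by simp) h)

theorem measurable_comap_of_eq_comp {Ω E : Type*} [mE : MeasurableSpace E]
    [DiscreteMeasurableSpace E] {U : Ω → E} {X : Ω → ℝ} (g : E → ℝ) (h : ∀ ω, X ω = g (U ω)) :
    Measurable[mE.comap U] X := by
  obtain rfl : X = g ∘ U := funext h
  exact (Measurable.of_discrete (f := g)).comp (comap_measurable U)

end Moments

/-! ### Outcomes as functions of the affecting treatments. -/

section Factorization

variable {n : ℕ} {y : Fin n → (Fin n → Bool) → ℝ}

/-- Pass from `z` to `z'` one coordinate at a time: a non-interfering coordinate cannot alter `y i`,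
and an interfering one does not change. -/
theorem eq_of_agree_on_interfering {i : Fin n} {z z' : Fin n → Bool}
    (h : ∀ j, Interferes y j i → z j = z' j) : y i z = y i z' := by
  classical
  have key : ∀ S : Finset (Fin n), y i (S.piecewise z' z) = y i z := by
    intro S
    induction S using Finset.induction_on with
    | empty => simp
    | insert j S hj ih =>
      rw [Finset.piecewise_insert, ← ih]
      by_cases hji : Interferes y j i
      · rw [← h j hji]
        congr 1
        rw [Function.update_eq_self_iff, Finset.piecewise_eq_of_notMem _ _ _ hj]
      · by_contra hne
        exact hji (Or.inr ⟨_, _, fun k hk => Function.update_of_ne hk _ _, hne⟩)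
  have := key Finset.univ
  rw [Finset.piecewise_univ] at this
  exact this.symm

theorem outcome_affecting (i : Fin n) (z : Fin n → Bool) : y i z = y i (affecting y i z) :=
  eq_of_agree_on_interfering fun j hj => by simp [affecting, hj]

/-- The convention `I_ii = 1` makes the weight of `i` a function of `affecting y i`, even if its
outcome ignores its own treatment. -/
theorem affecting_self (i : Fin n) (z : Fin n → Bool) : affecting y i z i = z i := by
  simp [affecting, Interferes]

theorem potential_affectingOthers (i : Fin n) (b : Bool) (z : Fin n → Bool) :
    potential y i b z =
      y i (fun j => if h : j = i then b else affectingOthers y i z ⟨j, h⟩) :=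
  eq_of_agree_on_interfering fun j hj => by
    by_cases h : j = i
    · subst h; simp
    · simp [h, affectingOthers, affecting, hj]

end Factorization

/-! ### Decomposition into arms, the rate, and the variance of a mean. -/

section Arms

open ProbabilityTheory

variable {n : ℕ} {P : Measure (Fin n → Bool)} {y : Fin n → (Fin n → Bool) → ℝ}

/-- The inverse probability weight of unit `i` in the arm `b`. -/
def armWeight (P : Measure (Fin n → Bool)) (b : Bool) (i : Fin n) (z : Fin n → Bool) : ℝ :=
  if z i = b then (P.real {z | z i = b})⁻¹ else 0

/-- The inverse probability weighted mean outcome in the arm `b`. -/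
def armMean (P : Measure (Fin n → Bool)) (y : Fin n → (Fin n → Bool) → ℝ) (b : Bool)
    (z : Fin n → Bool) : ℝ :=
  (1 / (n : ℝ)) * ∑ i, armWeight P b i z * y i z

/-- The mean inverse probability weight in the arm `b`. -/
def armNorm (P : Measure (Fin n → Bool)) (b : Bool) (z : Fin n → Bool) : ℝ :=
  (1 / (n : ℝ)) * ∑ i, armWeight P b i z

/-- The expected average potential outcome under own treatment `b`. -/
def armTarget (P : Measure (Fin n → Bool)) (y : Fin n → (Fin n → Bool) → ℝ) (b : Bool) : ℝ :=
  (1 / (n : ℝ)) * ∑ i, ∫ z, potential y i b z ∂P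

theorem one_sub_treatProb [IsProbabilityMeasure P] (i : Fin n) :
    1 - treatProb P i = P.real {z | z i = false} := by
  rw [treatProb, ← probReal_compl_eq_one_sub .of_discrete]
  congr 1
  ext z
  simp

theorem treat_div (i : Fin n) (z : Fin n → Bool) (c : ℝ) :
    treat (z i) * c / treatProb P i = armWeight P true i z * c := by
  cases h : z i <;> simp [treat, armWeight, h, treatProb, div_eq_inv_mul]

theorem one_sub_treat_div [IsProbabilityMeasure P] (i : Fin n) (z : Fin n → Bool) (c : ℝ) :
    (1 - treat (z i)) * c / (1 - treatProb P i) = armWeight P false i z * c := by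
  rw [one_sub_treatProb]
  cases h : z i <;> simp [treat, armWeight, h, div_eq_inv_mul]

theorem horvitzThompson_eq [IsProbabilityMeasure P] (z : Fin n → Bool) :
    horvitzThompson P y z = armMean P y true z - armMean P y false z := by
  simp only [horvitzThompson, armMean, treat_div, one_sub_treat_div]

theorem hajek_eq [IsProbabilityMeasure P] (hn : n ≠ 0) (z : Fin n → Bool) :
    hajek P y z = armMean P y true z / armNorm P true z
      - armMean P y false z / armNorm P false z := by
  have h1 : ∀ i, treat (z i) / treatProb P i = armWeight P true i z := fun i => by
    simpa using treat_div (P := P) i z 1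
  have h2 : ∀ i, (1 - treat (z i)) / (1 - treatProb P i) = armWeight P false i z := fun i => by
    simpa using one_sub_treat_div (P := P) i z 1
  have hn' : 1 / (n : ℝ) ≠ 0 := by positivity
  simp only [hajek, armMean, armNorm, treat_div, one_sub_treat_div, h1, h2,
    mul_div_mul_left _ _ hn']

theorem eate_eq [IsProbabilityMeasure P] : eate P y = armTarget P y true - armTarget P y false := by
  simp only [eate, acate, armTarget]
  rw [integral_const_mul, integral_finsetSum _ fun _ _ => .of_finite, ← mul_sub,
    ← Finset.sum_sub_distrib]
  congr 1
  exact Finset.sum_congr rfl fun i _ => integral_sub .of_finite .of_finite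

variable {k : ℝ}

theorem depInd_nonneg (i j : Fin n) : 0 ≤ depInd y i j := by
  unfold depInd; split_ifs <;> simp

theorem one_sub_depInd_nonneg (i j : Fin n) : 0 ≤ 1 - depInd y i j := by
  unfold depInd; split_ifs <;> simp

theorem powZero_nonneg {a e : ℝ} (ha : 0 ≤ a) : 0 ≤ powZero a e := by
  unfold powZero; split_ifs
  · exact le_rfl
  · exact Real.rpow_nonneg ha e

/-- Each unit depends on itself. This makes the rate positive, which the Markov step needs. -/
theorem dAvg_pos (hn : n ≠ 0) : 0 < dAvg y := by
  have : 0 < n := Nat.pos_of_ne_zero hn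
  refine mul_pos (by positivity) (Finset.sum_pos (fun i _ => ?_) ⟨⟨0, this⟩, Finset.mem_univ _⟩)
  refine Finset.sum_pos' (fun j _ => depInd_nonneg i j) ⟨i, Finset.mem_univ _, ?_⟩
  have : Dependent y i i := ⟨i, Or.inl rfl, Or.inl rfl⟩
  simp [depInd, this]

theorem dAvg_nonneg : 0 ≤ dAvg y :=
  mul_nonneg (by positivity)
    (Finset.sum_nonneg fun i _ => Finset.sum_nonneg fun j _ => depInd_nonneg i j)

theorem alphaExt_nonneg {q : ℝ≥0∞} : 0 ≤ alphaExt P y q :=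
  mul_nonneg (by positivity) (Finset.sum_nonneg fun i _ => Finset.sum_nonneg fun j _ =>
    mul_nonneg (one_sub_depInd_nonneg i j) (powZero_nonneg alphaMixing_nonneg))

theorem alphaInt_nonneg {s : ℝ≥0∞} : 0 ≤ alphaInt P y s :=
  Finset.sum_nonneg fun _ _ => powZero_nonneg alphaMixing_nonneg

theorem rate_eq {q s : ℝ≥0∞} : rate P y q s =
    (dAvg y / n) ^ (1 / 2 : ℝ) + (alphaExt P y q / n) ^ (1 / 2 : ℝ) + alphaInt P y s / n := by
  rw [rate, Real.div_rpow dAvg_nonneg (Nat.cast_nonneg n),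
    Real.div_rpow alphaExt_nonneg (Nat.cast_nonneg n), Real.rpow_neg (Nat.cast_nonneg n)]
  ring

theorem rate_pos {q s : ℝ≥0∞} (hn : n ≠ 0) : 0 < rate P y q s := by
  rw [rate_eq]
  have h1 := dAvg_pos (y := y) hn
  have h2 := alphaExt_nonneg (P := P) (y := y) (q := q)
  have h3 := alphaInt_nonneg (P := P) (y := y) (s := s)
  positivity

/-- Dropping the nonnegative cross terms of the square leaves the shape of variance plus squared
bias. -/
theorem le_rate_sq {q s : ℝ≥0∞} :
    (dAvg y + alphaExt P y q) / n + (alphaInt P y s / n) ^ 2 ≤ rate P y q s ^ 2 := by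
  rw [rate_eq]
  have h1 := dAvg_nonneg (y := y)
  have h2 := alphaExt_nonneg (P := P) (y := y) (q := q)
  have h3 := alphaInt_nonneg (P := P) (y := y) (s := s)
  have e : ∀ x : ℝ, 0 ≤ x → (x ^ (1 / 2 : ℝ)) ^ 2 = x := fun x hx => by
    rw [← Real.sqrt_eq_rpow, Real.sq_sqrt hx]
  have e1 := e (dAvg y / n) (by positivity)
  have e2 := e (alphaExt P y q / n) (by positivity)
  set u := (dAvg y / n) ^ (1 / 2 : ℝ)
  set v := (alphaExt P y q / n) ^ (1 / 2 : ℝ)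
  set w := alphaInt P y s / n
  have hu : 0 ≤ u := by positivity
  have hv : 0 ≤ v := by positivity
  have hw : 0 ≤ w := by positivity
  rw [add_div, ← e1, ← e2]
  nlinarith [mul_nonneg hu hv, mul_nonneg hu hw, mul_nonneg hv hw]

/-- The variance of the mean of variables that each depend only on the treatments affecting one
unit. -/
theorem variance_mean_le [IsProbabilityMeasure P] {q : ℝ≥0∞} {K : ℝ} (hK : 0 < K) (hq : 2 ≤ q)
    {f : Fin n → (Fin n → Bool) → ℝ} (hf : ∀ i z, f i z = f i (affecting y i z))
    (hfq : ∀ i, eLpNorm (f i) q P ≤ ENNReal.ofReal K) :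
    Var[fun z => (1 / (n : ℝ)) * ∑ i, f i z; P]
      ≤ 9 * K ^ 2 * ((dAvg y + alphaExt P y q) / n) := by
  have hij : ∀ i j, cov[f i, f j; P] ≤ 9 * K ^ 2 * (depInd y i j + (1 - depInd y i j) *
      powZero (alphaMixing P (affecting y i) (affecting y j)) (1 - 2 / q).toReal) := by
    intro i j
    refine (le_abs_self _).trans ?_
    by_cases h : Dependent y i j
    · simp only [depInd, h, if_true, sub_self, zero_mul, add_zero, mul_one]
      refine (abs_covariance_le_of_integral_sq (integral_sq_le hK.le hq (hfq i))
        (integral_sq_le hK.le hq (hfq j))).trans ?_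
      nlinarith [sq_nonneg K]
    · simp only [depInd, h, if_false, sub_zero, one_mul, zero_add]
      exact abs_covariance_le_powZero hK hq (measurable_comap_of_eq_comp _ (hf i))
        (measurable_comap_of_eq_comp _ (hf j)) (hfq i) (hfq j)
  rw [variance_const_mul, ← covariance_self (by fun_prop),
    covariance_fun_sum_fun_sum (fun _ => .of_discrete) (fun _ => .of_discrete)]
  calc _ ≤ (1 / (n : ℝ)) ^ 2 * ∑ i, ∑ j, 9 * K ^ 2 * (depInd y i j + (1 - depInd y i j) *
      powZero (alphaMixing P (affecting y i) (affecting y j)) (1 - 2 / q).toReal) := by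
        gcongr with i _ j _
        exact hij i j
    _ = _ := by
        simp only [← Finset.mul_sum, Finset.sum_add_distrib, dAvg, alphaExt]
        ring

theorem integral_sub_sq {Ω : Type*} [MeasurableSpace Ω] [Finite Ω] [DiscreteMeasurableSpace Ω]
    {P : Measure Ω} [IsProbabilityMeasure P] (X : Ω → ℝ) (c : ℝ) :
    ∫ ω, (X ω - c) ^ 2 ∂P = Var[X; P] + (P[X] - c) ^ 2 := by
  have h := variance_eq_sub (μ := P) (X := fun ω => X ω - c) .of_discrete
  rw [variance_sub_const (Measurable.of_discrete.aestronglyMeasurable),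
    integral_sub .of_finite .of_finite] at h
  simp only [integral_const, probReal_univ, smul_eq_mul, one_mul] at h
  rw [h]
  simp

theorem abs_armTarget_le [IsProbabilityMeasure P] {b : Bool} {s : ℝ≥0∞} (hk : 0 < k)
    (hs : 1 ≤ s)
    (hys : ∀ i, eLpNorm (potential y i b) s P ≤ ENNReal.ofReal k) : |armTarget P y b| ≤ k := by
  rw [armTarget, abs_mul, abs_of_nonneg (by positivity : (0 : ℝ) ≤ 1 / n)]
  have h : |∑ i, ∫ z, potential y i b z ∂P| ≤ n * k := by
    refine (Finset.abs_sum_le_sum_abs _ _).trans ?_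
    refine (Finset.sum_le_sum fun i _ => abs_integral_le hk.le hs (hys i)).trans ?_
    simp
  rcases eq_or_ne n 0 with hn | hn
  · simp [hn, hk.le]
  · rw [one_div, inv_mul_le_iff₀ (by positivity)]
    exact h

/-! ### Mean square errors of the weighted means and of the mean weights. -/

section Weights

variable (hk : 0 < k) {b : Bool} (hp : ∀ i, k⁻¹ ≤ P.real {z | z i = b})

include hk hp

theorem abs_armWeight_le (i : Fin n) (z : Fin n → Bool) : |armWeight P b i z| ≤ k := by
  unfold armWeight
  split_ifs
  · rw [abs_of_nonneg (by positivity)]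
    exact inv_le_of_inv_le₀ hk (hp i)
  · simpa using hk.le

theorem integral_armWeight (i : Fin n) : ∫ z, armWeight P b i z ∂P = 1 := by
  have h : armWeight P b i = {z | z i = b}.indicator fun _ => (P.real {z | z i = b})⁻¹ := by
    ext z
    simp [armWeight, Set.indicator_apply]
  have h0 : 0 < P.real {z | z i = b} := (inv_pos.2 hk).trans_le (hp i)
  rw [h, integral_indicator_const _ .of_discrete, smul_eq_mul, mul_inv_cancel₀ h0.ne']

variable [IsProbabilityMeasure P]

theorem integral_armNorm_sub_sq_le {q s : ℝ≥0∞} (hn : n ≠ 0) (hq : 2 ≤ q) :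
    ∫ z, (armNorm P b z - 1) ^ 2 ∂P ≤ 9 * k ^ 2 * rate P y q s ^ 2 := by
  have hmean : P[armNorm P b] = 1 := by
    simp only [armNorm]
    rw [integral_const_mul, integral_finsetSum _ fun _ _ => .of_finite]
    simp only [integral_armWeight hk hp]
    simp [hn]
  rw [integral_sub_sq, hmean, sub_self]
  have hv := variance_mean_le (P := P) (y := y) hk hq (f := armWeight P b)
    (fun i z => by simp only [armWeight, affecting_self])
    (fun i => by
      simpa using eLpNorm_le_of_ae_bound (p := q) (ae_of_all P (abs_armWeight_le hk hp i)))
  have hr := le_rate_sq (P := P) (y := y) (q := q) (s := s)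
  have hr' : (dAvg y + alphaExt P y q) / n ≤ rate P y q s ^ 2 := by
    linarith [sq_nonneg (alphaInt P y s / n)]
  have := mul_le_mul_of_nonneg_left hr' (by positivity : 0 ≤ 9 * k ^ 2)
  change Var[armNorm P b; P] ≤ _ at hv
  linarith

theorem abs_integral_armMean_sub_le {s : ℝ≥0∞} (hs : 1 ≤ s)
    (hys : ∀ i, eLpNorm (potential y i b) s P ≤ ENNReal.ofReal k) :
    |P[armMean P y b] - armTarget P y b| ≤ 6 * k ^ 2 * (alphaInt P y s / n) := by
  have hcov : ∀ i, ∫ z, armWeight P b i z * y i z ∂P - ∫ z, potential y i b z ∂P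
      = cov[armWeight P b i, potential y i b; P] := by
    intro i
    rw [covariance_eq_sub .of_discrete .of_discrete, integral_armWeight hk hp, one_mul]
    -- Where `z i = b`, resetting the own treatment to `b` changes nothing; elsewhere the weight is
    -- zero.
    congr 2
    ext z
    by_cases h : z i = b
    · simp [potential, ← h]
    · simp [armWeight, h]
  have heq : P[armMean P y b] - armTarget P y b
      = (1 / (n : ℝ)) * ∑ i, cov[armWeight P b i, potential y i b; P] := by
    simp only [armMean, armTarget]
    rw [integral_const_mul, integral_finsetSum _ fun _ _ => .of_finite, ← mul_sub,
      ← Finset.sum_sub_distrib]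
    simp only [hcov]
  rw [heq, abs_mul, abs_of_nonneg (by positivity : (0 : ℝ) ≤ 1 / n)]
  calc _ ≤ (1 / (n : ℝ)) * ∑ i, 6 * k * k *
        powZero (alphaMixing P (fun z => z i) (affectingOthers y i)) (1 - 1 / s).toReal := by
        gcongr
        refine (Finset.abs_sum_le_sum_abs _ _).trans (Finset.sum_le_sum fun i _ => ?_)
        exact abs_covariance_le_powZero_of_bounded hk hk.le hs
          (measurable_comap_of_eq_comp
            (fun c => if c = b then (P.real {z | z i = b})⁻¹ else 0) fun z => rfl)
          (measurable_comap_of_eq_comp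
            (fun w => y i (fun j => if h : j = i then b else w ⟨j, h⟩))
            (potential_affectingOthers i b)) (abs_armWeight_le hk hp i) (hys i)
    _ = _ := by
        rw [← Finset.mul_sum, alphaInt]
        ring

theorem integral_armMean_sub_sq_le {q s : ℝ≥0∞} (hq : 2 ≤ q) (hs : 1 ≤ s)
    (hyq : ∀ i, eLpNorm (y i) q P ≤ ENNReal.ofReal k)
    (hys : ∀ i, eLpNorm (potential y i b) s P ≤ ENNReal.ofReal k) :
    ∫ z, (armMean P y b z - armTarget P y b) ^ 2 ∂P ≤ 36 * k ^ 4 * rate P y q s ^ 2 := by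
  -- Weighted outcomes have norm at most `k * k`, so the variance constant is `9 * k ^ 4`; the
  -- squared bias has `36 * k ^ 4`, which dominates.
  have hv := variance_mean_le (P := P) (y := y) (mul_pos hk hk) hq
    (f := fun i z => armWeight P b i z * y i z)
    (fun i z => by simp only [armWeight, affecting_self, ← outcome_affecting])
    (fun i => by
      rw [ENNReal.ofReal_mul hk.le]
      refine (eLpNorm_le_mul_eLpNorm_of_ae_le_mul (g := y i) (c := k)
        (ae_of_all _ fun z => ?_) q).trans (by gcongr; exact hyq i)
      rw [norm_mul]
      exact mul_le_mul_of_nonneg_right (abs_armWeight_le hk hp i z) (norm_nonneg _))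
  have hb := pow_le_pow_left₀ (abs_nonneg _) (abs_integral_armMean_sub_le hk hp hs hys) 2
  rw [sq_abs] at hb
  have hr := mul_le_mul_of_nonneg_left (le_rate_sq (P := P) (y := y) (q := q) (s := s))
    (by positivity : 0 ≤ 36 * k ^ 4)
  have hd : 0 ≤ k ^ 4 * ((dAvg y + alphaExt P y q) / n) := by
    have := dAvg_nonneg (y := y)
    have := alphaExt_nonneg (P := P) (y := y) (q := q)
    positivity
  rw [integral_sub_sq]
  change Var[armMean P y b; P] ≤ _ at hv
  nlinarith

end Weights

end Arms

/-! ### Vanishing of the rate and the final assembly. -/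

theorem tendsto_rate {P : ∀ n : ℕ, Measure (Fin n → Bool)} [∀ n, IsProbabilityMeasure (P n)]
    {y : ∀ n : ℕ, Fin n → (Fin n → Bool) → ℝ} {q s : ℝ≥0∞}
    (hd : (fun n : ℕ => dAvg (y n)) =o[atTop] (fun n : ℕ => (n : ℝ)))
    (he : (fun n : ℕ => alphaExt (P n) (y n) q) =o[atTop] (fun n : ℕ => (n : ℝ)))
    (hi : (fun n : ℕ => alphaInt (P n) (y n) s) =o[atTop] (fun n : ℕ => (n : ℝ))) :
    Tendsto (fun n => rate (P n) (y n) q s) atTop (𝓝 0) := by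
  simp only [rate_eq]
  have h : ∀ {f : ℕ → ℝ}, f =o[atTop] (fun n : ℕ => (n : ℝ)) →
      Tendsto (fun n => (f n / n) ^ (1 / 2 : ℝ)) atTop (𝓝 0) := fun hf => by
    simpa using hf.tendsto_div_nhds_zero.rpow_const (p := 1 / 2) (Or.inr (by norm_num))
  simpa using ((h hd).add (h he)).add hi.tendsto_div_nhds_zero

end Interference

end
theorem proposition5
    (P : ∀ n : ℕ, Measure (Fin n → Bool)) [∀ n, IsProbabilityMeasure (P n)]
    (y : ∀ n : ℕ, Fin n → (Fin n → Bool) → ℝ)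
    (k : ℝ) (q s : ℝ≥0∞)
    (regular : Interference.Regular P y k q s)
    (restricted_interference :
      (fun n : ℕ => Interference.dAvg (y n)) =o[atTop] (fun n : ℕ => (n : ℝ)))
    (design_mixing :
      (fun n : ℕ => Interference.alphaExt (P n) (y n) q) =o[atTop] (fun n : ℕ => (n : ℝ)))
    (design_separation :
      (fun n : ℕ => Interference.alphaInt (P n) (y n) s) =o[atTop] (fun n : ℕ => (n : ℝ))) :
    (Interference.TendstoZeroInProb P
        (fun n z => Interference.horvitzThompson (P n) (y n) z - Interference.eate (P n) (y n)) ∧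
      Interference.TendstoZeroInProb P
        (fun n z => Interference.hajek (P n) (y n) z - Interference.eate (P n) (y n))) ∧
    (Interference.IsBigOInProb P
        (fun n z => Interference.horvitzThompson (P n) (y n) z - Interference.eate (P n) (y n))
        (fun n => Interference.rate (P n) (y n) q s) ∧
      Interference.IsBigOInProb P
        (fun n z => Interference.hajek (P n) (y n) z - Interference.eate (P n) (y n))
        (fun n => Interference.rate (P n) (y n) q s)) := by
  open Interference in
  have hk := regular.k_pos
  have hp : ∀ n b (i : Fin n), k⁻¹ ≤ (P n).real {z | z i = b} := by
    intro n b i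
    obtain ⟨h1, h2⟩ := regular.prob_assignment n i
    cases b
    · rw [← one_sub_treatProb]; linarith
    · exact h1
  have hrate := tendsto_rate restricted_interference design_mixing design_separation
  have hpos : ∀ᶠ n in atTop, 0 < rate (P n) (y n) q s :=
    (eventually_ne_atTop 0).mono fun n hn => rate_pos hn
  have hmean : ∀ b, IsBigOInProb P
      (fun n z => armMean (P n) (y n) b z - armTarget (P n) (y n) b)
      (fun n => rate (P n) (y n) q s) := fun b =>
    .of_integral_sq_le (C := 36 * k ^ 4) (by positivity)
      (.of_forall fun n => ⟨.of_finite, integral_armMean_sub_sq_le hk (hp n b) regular.two_le_q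
        regular.one_le_s (regular.outcome_moments n)
        fun i => regular.potential_moments n i b⟩) hpos
  have hnorm : ∀ b, IsBigOInProb P (fun n z => armNorm (P n) b z - 1)
      (fun n => rate (P n) (y n) q s) := fun b =>
    .of_integral_sq_le (C := 9 * k ^ 2) (by positivity)
      ((eventually_ne_atTop 0).mono fun n hn => ⟨.of_finite,
        integral_armNorm_sub_sq_le hk (hp n b) hn regular.two_le_q⟩) hpos
  have hratio : ∀ b, IsBigOInProb P
      (fun n z => armMean (P n) (y n) b z / armNorm (P n) b z - armTarget (P n) (y n) b)
      (fun n => rate (P n) (y n) q s) := fun b =>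
    (hmean b).div_sub (hnorm b) (.of_forall fun n => abs_armTarget_le hk
      regular.one_le_s fun i => regular.potential_moments n i b) hrate
  have hHT : IsBigOInProb P (fun n z => horvitzThompson (P n) (y n) z - eate (P n) (y n))
      (fun n => rate (P n) (y n) q s) := by
    refine ((hmean true).sub (hmean false)).congr (.of_forall fun n => ?_)
    ext z
    rw [horvitzThompson_eq, eate_eq]
    ring
  have hHA : IsBigOInProb P (fun n z => hajek (P n) (y n) z - eate (P n) (y n))
      (fun n => rate (P n) (y n) q s) := by
    -- Cancelling `1 / n` from numerator and denominator in `hajek_eq` uses `n ≠ 0`.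
    refine ((hratio true).sub (hratio false)).congr ((eventually_ne_atTop 0).mono fun n hn => ?_)
    ext z
    rw [hajek_eq hn, eate_eq]
    ring
  exact ⟨⟨hHT.tendstoZeroInProb hrate, hHA.tendstoZeroInProb hrate⟩, hHT, hHA⟩
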